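/- Let $G$ be a finite simple $d$-regular graph with $n$ vertices and adjacency matrix $A$. Let $J$ be the $n\times n$ all-ones matrix, let $M_{d,k}=1+d+d(d-1)+\dots+d(d-1)^{k-1}$ be the Moore bound, and let $G_{d,m}(x)$ be the polynomials given by $G_{d,0}=1$, $G_{d,1}=x+1$ and $G_{d,m+1}=xG_{d,m}-(d-1)G_{d,m-1}$ for $m\ge 1$. Say that $G$ has *cyclic defect* if, for $D\ge 2$ its diameter, $n=M_{d,D}-2$ and $G_{d,D}(A)=J+B$, where $B$ is, for a suitable labelling of the vertices, the adjacency matrix of the cycle $C_n$. Say that $G$ has *cyclic excess* if its girth $g\ge 5$ is odd, $n=M_{d,(g-1)/2}+2$ and $G_{d,(g-1)/2}(A)=J-B$, where again $B$ is, for a suitable labelling of the vertices, the adjacency matrix of the cycle $C_n$. For every odd integer $d\ge 5$ there are, up to isomorphism, only finitely many graphs of degree $d$ with cyclic defect or cyclic excess, over all diameters $D\ge 2$ and all odd girths $g\ge 5$ together. Moreover, if $N(d)$ denotes their number, then $N(d)=O\!\left(\tfrac{64}{3}d^{3/2}\right)$ as $d\to\infty$ through the odd integers, where the constant $\tfrac{64}{3}$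 is meant as an asymptotic leading constant: for every $\varepsilon>0$, $N(d)\le\left(\tfrac{64}{3}+\varepsilon\right)d^{3/2}$ for all sufficiently large odd $d$. -/

import Mathlib

open Filter Asymptotics

/-- The Moore bound `M_{d,k} = 1 + d + d(d-1) + ... + d(d-1)^(k-1)` (used for `d ≥ 1`). -/
def mooreBound (d k : ℕ) : ℕ :=
  1 + d * ∑ i ∈ Finset.range k, (d - 1) ^ i

/-- The polynomials `G_{d,m}`: `G_{d,0} = 1`, `G_{d,1} = x + 1` and
`G_{d,m+1} = x G_{d,m} - (d-1) G_{d,m-1}` for `m ≥ 1`. -/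
noncomputable def moorePoly (d : ℕ) : ℕ → Polynomial ℤ
  | 0 => 1
  | 1 => Polynomial.X + 1
  | m + 2 =>
      Polynomial.X * moorePoly d (m + 1) - Polynomial.C ((d : ℤ) - 1) * moorePoly d m

section Graphs

variable {V : Type*} [Fintype V] [DecidableEq V]

/-- `B` is, for a suitable labelling of its rows and columns (the same for both), the adjacency
matrix `A(C_n)` of the cycle on all `n` elements of the index set.
(It is only used for large `n`, so that the cycle is a simple graph.) -/
def IsCycleMatrix (B : Matrix V V ℤ) : Prop :=
  ∃ e : V ≃ Fin (Fintype.card V),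
    B = ((SimpleGraph.cycleGraph (Fintype.card V)).adjMatrix ℤ).submatrix e e

/-- `G` is a regular graph of degree `d`, diameter `D ≥ 2` and defect `2` whose defect matrix
`B`, determined by `G_{d,D}(A) = J + B`, is the adjacency matrix of an `n`-cycle. -/
structure HasCyclicDefect (G : SimpleGraph V) [DecidableRel G.Adj] (d D : ℕ) : Prop where
  two_le : 2 ≤ D
  regular : G.IsRegularOfDegree d
  diameter : G.ediam = (D : ℕ∞)
  order : Fintype.card V + 2 = mooreBound d D
  cyclic : ∃ B : Matrix V V ℤ, IsCycleMatrix B ∧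
    Polynomial.aeval (G.adjMatrix ℤ) (moorePoly d D) = Matrix.of (fun _ _ => 1) + B

/-- `G` is a regular graph of degree `d`, odd girth `g ≥ 5` and excess `2` whose excess matrix
`B`, determined by `G_{d,⌊g/2⌋}(A) = J - B`, is the adjacency matrix of an `n`-cycle. -/
structure HasCyclicExcess (G : SimpleGraph V) [DecidableRel G.Adj] (d g : ℕ) : Prop where
  five_le : 5 ≤ g
  odd : Odd g
  regular : G.IsRegularOfDegree d
  girth : G.egirth = (g : ℕ∞)
  order : Fintype.card V = mooreBound d (g / 2) + 2
  cyclic : ∃ B : Matrix V V ℤ, IsCycleMatrix B ∧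
    Polynomial.aeval (G.adjMatrix ℤ) (moorePoly d (g / 2)) = Matrix.of (fun _ _ => 1) - B

end Graphs

/-- Isomorphism of finite graphs (every finite graph is isomorphic to one on some `Fin n`). -/
def finiteGraphSetoid : Setoid (Σ n : ℕ, SimpleGraph (Fin n)) where
  r G H := Nonempty (G.2 ≃g H.2)
  iseqv :=
    { refl := fun _ => ⟨SimpleGraph.Iso.refl⟩
      symm := fun ⟨e⟩ => ⟨e.symm⟩
      trans := fun ⟨e⟩ ⟨f⟩ => ⟨e.trans f⟩ }

/-- Isomorphism classes of finite graphs. -/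
abbrev GraphClass : Type := Quotient finiteGraphSetoid

/-- The isomorphism classes of graphs of degree `d` with cyclic defect (of any diameter) or
cyclic excess (of any odd girth). -/
def cyclicGraphClasses (d : ℕ) : Set GraphClass :=
  {c | ∃ (n : ℕ) (G : SimpleGraph (Fin n)),
    letI : DecidableRel G.Adj := Classical.decRel _
    c = Quotient.mk finiteGraphSetoid ⟨n, G⟩ ∧
      ((∃ D, HasCyclicDefect G d D) ∨ (∃ g, HasCyclicExcess G d g))}

/-! Graphs of odd degree `d ≥ 5` with cyclic defect or excess do not exist, so that
`N(d) = 0` for these `d`, which is stronger than the bound `O(64/3 d^(3/2))`.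

The adjacency matrix commutes with that of the cycle, so it solves the discrete wave equation on
the torus `ZMod n × ZMod n`. A `0`-`1` solution with zero diagonal is constant along diagonals in
the even part, and constant along diagonals or along antidiagonals in the odd part. Either form
produces too many pairs of vertices joined by two paths of length two, unless the graph is
bipartite, and then `-d` is an eigenvalue, which forces `(1 - d) ^ k = ± 2`. -/

/-! By regularity `A` commutes with `J`, so `G_{d,k}(A) = J ± B` makes it commute with `B`;
entrywise this is the wave equation. The Moore bound is even for odd `d`, hence so is `n`, and
parity is a proper notion on `ZMod n`. `IsWave.dichotomy` makes the adjacency of `i` and `j` depend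
on `j - i` alone, except that for odd `j - i` it may depend on `i + j` instead. Suitable neighbours
`a`, `b` of `0` then give two paths of length two from `0` to `a + b` or to `b - a`. Entries of
`G_{d,k}(A)` dominate those of `G_{d,2}(A)`, which count such paths, whereas entries of `J ± B` are
`1` away from the cycle edges; so the endpoint would have to be `0` or `±1`, and having `d ≥ 5`
neighbours leaves room to avoid this. In the mixed case `a` must be even. If no edge joins vertices
of equal parity, the alternating vector gives `(1 - d) ^ k = ± 2`, impossible for `d ≥ 5`. -/

/-! ### Moore polynomials and nonbacktracking walks. -/

section MoorePoly

/-- The value of the polynomial `G_{d,k}` at `-d`. -/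
theorem eval_neg_moorePoly (d k : ℕ) : (moorePoly d k).eval (-(d : ℤ)) = (1 - d) ^ k := by
  induction k using Nat.twoStepInduction with
  | zero => simp [moorePoly]
  | one => simp [moorePoly]; ring
  | more k h₀ h₁ =>
    simp only [moorePoly, Polynomial.eval_sub, Polynomial.eval_mul, Polynomial.eval_X,
      Polynomial.eval_C, h₀, h₁]
    ring

variable {V : Type*} [Fintype V] [DecidableEq V]

theorem aeval_mulVec_of_eigenvector {A : Matrix V V ℤ} {u : V → ℤ} {c : ℤ}
    (h : A.mulVec u = c • u) (p : Polynomial ℤ) :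
    (Polynomial.aeval A p).mulVec u = p.eval c • u := by
  induction p using Polynomial.induction_on' with
  | add p q hp hq => simp [Matrix.add_mulVec, hp, hq, add_smul]
  | monomial k a =>
    have hk : (A ^ k).mulVec u = c ^ k • u := by
      induction k with
      | zero => simp
      | succ k ih => rw [pow_succ, ← Matrix.mulVec_mulVec, h, Matrix.mulVec_smul, ih, smul_smul,
          pow_succ, mul_comm]
    rw [Polynomial.aeval_monomial, Polynomial.eval_monomial, ← Matrix.mulVec_mulVec, hk,
      Matrix.mulVec_smul, Algebra.algebraMap_eq_smul_one, Matrix.smul_mulVec, Matrix.one_mulVec,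
      smul_smul, mul_comm]

/-- Weighted count of the nonbacktracking walks of length `m + 1` that start at `i` and end with
the arc from `u` to `v`. -/
def nonbacktrackingCount (A : Matrix V V ℤ) (i : V) : ℕ → V → V → ℤ
  | 0, u, v => if i = u then A u v else 0
  | m + 1, u, v => A u v * ∑ w ∈ Finset.univ.erase v, nonbacktrackingCount A i m w u

theorem nonbacktrackingCount_nonneg {A : Matrix V V ℤ} (hA : ∀ u v, 0 ≤ A u v) (i : V) (m : ℕ)
    (u v : V) : 0 ≤ nonbacktrackingCount A i m u v := by
  induction m generalizing u v with
  | zero => unfold nonbacktrackingCount; split_ifs <;> simp [hA]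
  | succ m ih => exact mul_nonneg (hA u v) (Finset.sum_nonneg fun w _ => ih w u)

theorem mul_nonbacktrackingCount {A : Matrix V V ℤ} (hA : ∀ u v, A u v * A u v = A u v) (i : V)
    (m : ℕ) (u v : V) :
    A u v * nonbacktrackingCount A i m u v = nonbacktrackingCount A i m u v := by
  cases m with
  | zero => unfold nonbacktrackingCount; split_ifs <;> simp [hA]
  | succ m => rw [nonbacktrackingCount, ← mul_assoc, hA]

/-- All one-step extensions, minus those that return along the last arc. -/
theorem sum_nonbacktrackingCount_succ {A : Matrix V V ℤ} (i : V) (m : ℕ) (w : V) :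
    ∑ v, nonbacktrackingCount A i (m + 1) v w =
      ∑ v, (∑ u, nonbacktrackingCount A i m u v) * A v w
        - ∑ v, A v w * nonbacktrackingCount A i m w v := by
  rw [← Finset.sum_sub_distrib]
  refine Finset.sum_congr rfl fun v _ => ?_
  rw [nonbacktrackingCount, ← Finset.add_sum_erase _ _ (Finset.mem_univ w)]
  ring

/-- Both sides obey the same three-term recurrence. Since walk counts are nonnegative, `G_{d,m}(A)`
is therefore entrywise nondecreasing from `m` to `m + 1`. -/
theorem sum_nonbacktrackingCount {A : Matrix V V ℤ} {d : ℕ} (hA : ∀ u v, A u v * A u v = A u v)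
    (hs : ∀ u v, A u v = A v u) (hd : ∀ u, ∑ v, A u v = d) (i : V) (m : ℕ) (v : V) :
    ∑ u, nonbacktrackingCount A i m u v =
      Polynomial.aeval A (moorePoly d (m + 1) - moorePoly d m) i v := by
  induction m using Nat.twoStepInduction generalizing v with
  | zero => simp [nonbacktrackingCount, moorePoly]
  | one =>
    have h₁ : ∀ u, ∑ w, nonbacktrackingCount A i 0 w u = A i u := by simp [nonbacktrackingCount]
    have h₂ : ∑ u, A u v * nonbacktrackingCount A i 0 v u = if i = v then (d : ℤ) else 0 := by
      by_cases h : i = v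
      · simp only [nonbacktrackingCount, h, if_true, ← hd v]
        exact Finset.sum_congr rfl fun u _ => by rw [hs u v, hA]
      · simp [nonbacktrackingCount, h]
    -- The constant is `d`, not `d - 1`: the empty walk has no last arc that restricts its first
    -- step.
    have h₃ : moorePoly d 2 - moorePoly d 1 =
        Polynomial.X * Polynomial.X - Polynomial.C (d : ℤ) := by
      simp only [moorePoly, map_sub, map_one]; ring
    have h₄ : Polynomial.aeval A (moorePoly d 2 - moorePoly d 1) = A * A - (d : ℤ) • 1 := by
      rw [h₃, map_sub, map_mul, Polynomial.aeval_X, Polynomial.aeval_C,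
        Algebra.algebraMap_eq_smul_one]
    rw [sum_nonbacktrackingCount_succ, h₂, h₄, Matrix.sub_apply, Matrix.mul_apply]
    simp only [h₁, Matrix.smul_apply, Matrix.one_apply, smul_eq_mul, mul_ite, mul_one, mul_zero]
  | more m h₀ h₁ =>
    have h₃ : moorePoly d (m + 3) - moorePoly d (m + 2) =
        (moorePoly d (m + 2) - moorePoly d (m + 1)) * Polynomial.X
          - Polynomial.C ((d : ℤ) - 1) * (moorePoly d (m + 1) - moorePoly d m) := by
      simp only [moorePoly]; ring
    -- A walk ending at `v` can go out to a neighbour and straight back in `d - 1` ways, since the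
    -- neighbour it came from is excluded.
    have h₂ : ∑ u, A u v * nonbacktrackingCount A i (m + 1) v u =
        ((d : ℤ) - 1) * ∑ u, nonbacktrackingCount A i m u v := by
      have : ∀ u, A u v * nonbacktrackingCount A i (m + 1) v u =
          A v u * (∑ w, nonbacktrackingCount A i m w v) - nonbacktrackingCount A i m u v := by
        intro u
        rw [nonbacktrackingCount, ← Finset.add_sum_erase _ _ (Finset.mem_univ u),
          ← mul_assoc, hs u v, hA, mul_add]
        nth_rewrite 2 [hs v u]
        rw [mul_nonbacktrackingCount hA]
        ring
      rw [Finset.sum_congr rfl fun u _ => this u, Finset.sum_sub_distrib, ← Finset.sum_mul, hd]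
      ring
    have h₄ : Polynomial.aeval A (moorePoly d (m + 3) - moorePoly d (m + 2)) =
        Polynomial.aeval A (moorePoly d (m + 2) - moorePoly d (m + 1)) * A
          - ((d : ℤ) - 1) • Polynomial.aeval A (moorePoly d (m + 1) - moorePoly d m) := by
      rw [h₃, map_sub _ (_ * _) _, map_mul, map_mul, Polynomial.aeval_X,
        Polynomial.aeval_C, Algebra.algebraMap_eq_smul_one, smul_mul_assoc, one_mul]
    rw [sum_nonbacktrackingCount_succ, h₂, h₄, h₀, Matrix.sub_apply, Matrix.mul_apply,
      Matrix.smul_apply, smul_eq_mul]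
    simp only [h₁]

/-- In a regular graph, the entries of `G_{d,k}(A)` dominate those of `G_{d,2}(A)` for `k ≥ 2`. -/
theorem aeval_moorePoly_two_le {A : Matrix V V ℤ} {d : ℕ} (h0 : ∀ u v, 0 ≤ A u v)
    (hA : ∀ u v, A u v * A u v = A u v)
    (hs : ∀ u v, A u v = A v u) (hd : ∀ u, ∑ v, A u v = d) {k : ℕ} (hk : 2 ≤ k) (i j : V) :
    Polynomial.aeval A (moorePoly d 2) i j ≤ Polynomial.aeval A (moorePoly d k) i j := by
  induction k, hk using Nat.le_induction with
  | base => rfl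
  | succ k _ ih =>
    have h := sum_nonbacktrackingCount hA hs hd i k j
    rw [map_sub, Matrix.sub_apply] at h
    have h' := Finset.sum_nonneg fun u (_ : u ∈ Finset.univ) =>
      nonbacktrackingCount_nonneg h0 i k u j
    linarith

end MoorePoly

/-! ### Parity in `ZMod n` and 0-1 solutions of the wave equation. -/

section Wave

variable {n : ℕ}

theorem ZMod.even_or_even_add_one [NeZero n] (x : ZMod n) : Even x ∨ Even (x + 1) := by
  obtain ⟨k, rfl⟩ := ZMod.natCast_zmod_surjective x
  rcases Nat.even_or_odd k with h | h
  · exact Or.inl (h.map (Nat.castRingHom (ZMod n)))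
  · right
    have := (h.add_odd odd_one).map (Nat.castRingHom (ZMod n))
    simpa using this

theorem ZMod.not_even_one_of_even (hn : Even n) : ¬ Even (1 : ZMod n) := by
  intro h
  obtain ⟨r, hr⟩ := h.map (ZMod.castHom hn.two_dvd (ZMod 2))
  rw [map_one] at hr
  revert r
  decide

theorem ZMod.even_sub_of_not_even [NeZero n] {x y : ZMod n} (hx : ¬ Even x) (hy : ¬ Even y) :
    Even (x - y) := by
  have := ((ZMod.even_or_even_add_one x).resolve_left hx).sub
    ((ZMod.even_or_even_add_one y).resolve_left hy)
  simpa using this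

theorem ZMod.eq_add_of_forall_add_one [NeZero n] {α : Type*} {f : ZMod n → α}
    (h : ∀ t, f (t + 1) = f t) (t : ZMod n) : f t = f 0 := by
  obtain ⟨k, rfl⟩ := ZMod.natCast_zmod_surjective t
  induction k with
  | zero => simp
  | succ k ih => rw [Nat.cast_succ, h, ih]

/-- The discrete wave equation on the torus. -/
def IsWave (f : ZMod n → ZMod n → ℤ) : Prop :=
  ∀ i j, f (i + 1) j + f (i - 1) j = f i (j + 1) + f i (j - 1)

/-- The wave equation rearranges to `f (i + 1) j - f i (j - 1) = f i (j + 1) - f (i - 1) j`: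
diagonal increments are constant along antidiagonals. -/
theorem IsWave.sub_eq [NeZero n] {f : ZMod n → ZMod n → ℤ} (hf : IsWave f)
    {x y x' y' : ZMod n}
    (h : x + y = x' + y') : f (x + 1) (y + 1) - f x y = f (x' + 1) (y' + 1) - f x' y' := by
  have key := ZMod.eq_add_of_forall_add_one
    (f := fun t => f (x + t + 1) (y - t + 1) - f (x + t) (y - t)) (fun t => by
      have := hf (x + t + 1) (y - t)
      simp only [add_sub_cancel_right] at this
      simp only [← add_assoc, sub_add_cancel, sub_add_eq_sub_sub]
      linarith) (x' - x)
  have hy : y - (x' - x) = y' := by linear_combination h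
  simpa [hy] using key.symm

/-- This reflection exchanges diagonals and antidiagonals, so `IsWave.sub_eq` also controls
antidiagonal increments. -/
theorem IsWave.neg {f : ZMod n → ZMod n → ℤ} (hf : IsWave f) : IsWave fun i j => f i (-j) := by
  intro i j
  have := hf i (-j)
  simp only [neg_add, neg_sub]
  rw [this, ← sub_eq_add_neg, add_comm, neg_add_eq_sub]

/-- A `0`-`1` solution of the wave equation with zero diagonal is constant along the diagonals
in the even part, and along the diagonals or the antidiagonals in the odd part. -/
theorem IsWave.dichotomy [NeZero n] {f : ZMod n → ZMod n → ℤ} (hf : IsWave f)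
    (h01 : ∀ i j, f i j = 0 ∨ f i j = 1) (h0 : ∀ i, f i i = 0) :
    (∀ x y, Even (x + y) → f (x + 1) (y + 1) = f x y) ∧
      ((∀ x y, f (x + 1) (y + 1) = f x y) ∨
        ∀ x y, ¬ Even (x + y) → f (x + 1) (y - 1) = f x y) := by
  have heven : ∀ x y, Even (x + y) → f (x + 1) (y + 1) = f x y := by
    -- The antidiagonal of `(x, y)` meets the main diagonal at `(z, z)`, where the increment
    -- vanishes.
    rintro x y ⟨z, hz⟩
    have := hf.sub_eq hz
    rw [h0, h0] at this
    linarith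
  refine ⟨heven, ?_⟩
  by_cases hc : ∀ x y, f (x + 1) (y + 1) = f x y
  · exact Or.inl hc
  right
  push Not at hc
  obtain ⟨a, b, hab⟩ := hc
  have hodd : ¬ Even (a + b) := fun h => hab (heven a b h)
  -- A nonzero increment between 0-1 values determines both of them, and the increment is the same
  -- all along this antidiagonal.
  have hconst : ∀ x y, x + y = a + b → f x y = f a b := by
    intro x y h
    have := hf.sub_eq h
    rcases h01 x y with h₁ | h₁ <;> rcases h01 a b with h₂ | h₂ <;>
    rcases h01 (x + 1) (y + 1) with h₃ | h₃ <;> rcases h01 (a + 1) (b + 1) with h₄ | h₄ <;>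
    simp_all
  intro x y hxy
  -- Shifting by `(r, r)` moves `(x, y)` onto the antidiagonal of `(a, b)`, and antidiagonal
  -- increments are unchanged by diagonal shifts.
  obtain ⟨r, hr⟩ := ZMod.even_sub_of_not_even hodd hxy
  have key : f (x + 1) (y - 1) - f x y = f (x + r + 1) (y + r - 1) - f (x + r) (y + r) := by
    convert hf.neg.sub_eq (x := x) (y := -y) (x' := x + r) (y' := -(y + r)) (by ring)
      using 3 <;> ring
  have e₁ := hconst (x + r) (y + r) (by linear_combination -hr)
  have e₂ := hconst (x + r + 1) (y + r - 1) (by linear_combination -hr)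
  linarith

end Wave

/-! ### Nonexistence of solutions on `ZMod n`. -/

section CycleEquation

variable {n d k : ℕ} [NeZero n] {H : SimpleGraph (ZMod n)} [DecidableRel H.Adj] {σ : ℤ}

/-- `G_{d,k}(A) = J + σ B`, where `B` is the adjacency matrix of the cycle on `ZMod n`. -/
def SatisfiesCycleEquation (H : SimpleGraph (ZMod n)) [DecidableRel H.Adj] (d k : ℕ) (σ : ℤ) :
    Prop :=
  ∀ i j, Polynomial.aeval (H.adjMatrix ℤ) (moorePoly d k) i j =
    1 + σ * ((if j = i + 1 then 1 else 0) + if j = i - 1 then 1 else 0)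

theorem SatisfiesCycleEquation.isWave (h : SatisfiesCycleEquation H d k σ)
    (hd : H.IsRegularOfDegree d) (hσ : σ = 1 ∨ σ = -1) : IsWave fun i j => H.adjMatrix ℤ i j := by
  intro i j
  have hcomm : H.adjMatrix ℤ * Polynomial.aeval (H.adjMatrix ℤ) (moorePoly d k) =
      Polynomial.aeval (H.adjMatrix ℤ) (moorePoly d k) * H.adjMatrix ℤ := by
    simpa only [map_mul, Polynomial.aeval_X] using
      congrArg (Polynomial.aeval (H.adjMatrix ℤ)) (mul_comm Polynomial.X (moorePoly d k))
  have hrow : ∀ i, ∑ l, H.adjMatrix ℤ i l = d := fun i => by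
    simpa [Matrix.mulVec, dotProduct, hd.degree_eq] using
      SimpleGraph.adjMatrix_mulVec_const_apply (G := H) (a := (1 : ℤ)) (v := i)
  have hcol : ∀ j, ∑ l, H.adjMatrix ℤ l j = d := fun j => by
    rw [← hrow j]
    exact Finset.sum_congr rfl fun l _ => (H.isSymm_adjMatrix (α := ℤ)).apply j l
  have hl := congrFun (congrFun hcomm i) j
  have e₁ : ∀ l : ZMod n, (j = l + 1) ↔ (l = j - 1) := fun l => by
    rw [eq_sub_iff_add_eq, eq_comm]
  have e₂ : ∀ l : ZMod n, (j = l - 1) ↔ (l = j + 1) := fun l => by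
    rw [eq_sub_iff_add_eq, eq_comm]
  simp only [Matrix.mul_apply, h _ _, e₁, e₂, mul_add, add_mul, mul_one, one_mul, mul_ite, ite_mul,
    mul_zero, zero_mul, Finset.sum_add_distrib, Finset.sum_ite_eq',
    Finset.mem_univ, if_true, hrow, hcol] at hl
  rcases hσ with rfl | rfl <;> linarith

/-- Otherwise the `(x, c)` entry of `G_{d,k}(A)` equals `1`, while that of `G_{d,2}(A) = A² + A - (d
- 1)I` is at least `2`. -/
theorem SatisfiesCycleEquation.eq_of_two_paths (h : SatisfiesCycleEquation H d k σ)
    (hd : H.IsRegularOfDegree d) (hk : 2 ≤ k) {x a b c : ZMod n} (hab : a ≠ b)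
    (hxa : H.Adj x a) (hxb : H.Adj x b) (hac : H.Adj a c) (hbc : H.Adj b c) (hxc : x ≠ c) :
    c = x + 1 ∨ c = x - 1 := by
  by_contra! hc
  have h01 : ∀ u v, H.adjMatrix ℤ u v = 0 ∨ H.adjMatrix ℤ u v = 1 := fun u v => by
    rw [SimpleGraph.adjMatrix_apply]; split_ifs <;> simp
  have h0 : ∀ u v, 0 ≤ H.adjMatrix ℤ u v := fun u v => by
    rcases h01 u v with e | e <;> simp only [e] <;> norm_num
  have hle := aeval_moorePoly_two_le (A := H.adjMatrix ℤ) (d := d) h0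
    (fun u v => by rcases h01 u v with e | e <;> simp only [e] <;> norm_num)
    (fun u v => (H.isSymm_adjMatrix (α := ℤ)).apply v u)
    (fun i => by
      simpa [Matrix.mulVec, dotProduct, hd.degree_eq] using
        SimpleGraph.adjMatrix_mulVec_const_apply (G := H) (a := (1 : ℤ)) (v := i)) hk x c
  rw [h x c, if_neg hc.1, if_neg hc.2] at hle
  have h₂ : Polynomial.aeval (H.adjMatrix ℤ) (moorePoly d 2) =
      H.adjMatrix ℤ * (H.adjMatrix ℤ + 1) - ((d : ℤ) - 1) • 1 := by
    rw [moorePoly, moorePoly, moorePoly, map_sub _ (_ * _) _, map_mul, mul_one, map_add, map_one,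
      Polynomial.aeval_X, Polynomial.aeval_C, Algebra.algebraMap_eq_smul_one]
  have hsum : ∑ l ∈ ({a, b} : Finset (ZMod n)), H.adjMatrix ℤ x l * H.adjMatrix ℤ l c ≤
      ∑ l, H.adjMatrix ℤ x l * H.adjMatrix ℤ l c :=
    Finset.sum_le_sum_of_subset_of_nonneg (Finset.subset_univ _)
      fun l _ _ => mul_nonneg (h0 _ _) (h0 _ _)
  rw [Finset.sum_pair hab] at hsum
  rw [h₂, mul_add, mul_one, Matrix.sub_apply, Matrix.add_apply, Matrix.mul_apply, Matrix.smul_apply,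
    Matrix.one_apply_ne hxc] at hle
  have := h0 x c
  simp only [SimpleGraph.adjMatrix_apply, hxa, hxb, hac, hbc, if_true, smul_zero] at *
  linarith

/-- The alternating vector on `ZMod n`. -/
noncomputable def alternating (x : ZMod n) : ℤ :=
  open Classical in if Even x then 1 else -1

theorem alternating_add_one (hn : Even n) (x : ZMod n) :
    alternating (x + 1) = -alternating x := by
  unfold alternating
  by_cases h : Even x
  · have : ¬ Even (x + 1) := fun h' => ZMod.not_even_one_of_even hn (by simpa using h'.sub h)
    simp [h, this]
  · simp [h, (ZMod.even_or_even_add_one x).resolve_left h]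

theorem sum_alternating (hn : Even n) : ∑ x : ZMod n, alternating x = 0 := by
  have h := Equiv.sum_comp (Equiv.addRight (1 : ZMod n)) alternating
  simp only [Equiv.coe_addRight, alternating_add_one hn, Finset.sum_neg_distrib] at h
  linarith

/-- Otherwise parity is a bipartition and the alternating vector is an eigenvector of `A` for `-d`.
It is killed by `J` and multiplied by `-2` by `B`, so `(1 - d) ^ k = -2σ` and `d - 1` divides `2`.
-/
theorem SatisfiesCycleEquation.exists_even_adj (h : SatisfiesCycleEquation H d k σ) (hn : Even n)
    (hd : H.IsRegularOfDegree d) (hσ : σ = 1 ∨ σ = -1) (h5 : 5 ≤ d) (hk : 2 ≤ k) :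
    ∃ x y, Even (y - x) ∧ H.Adj x y := by
  by_contra! hno
  have halt : ∀ x y, H.Adj x y → alternating y = -alternating x := by
    intro x y hxy
    unfold alternating
    by_cases hx : Even x <;> by_cases hy : Even y
    · exact absurd hxy (hno x y (hy.sub hx))
    · simp [hx, hy]
    · simp [hx, hy]
    · exact absurd hxy (hno x y (ZMod.even_sub_of_not_even hy hx))
  have heig : (H.adjMatrix ℤ).mulVec alternating = (-(d : ℤ)) • alternating := by
    ext x
    rw [SimpleGraph.adjMatrix_mulVec_apply,
      Finset.sum_congr rfl fun y hy => halt x y ((H.mem_neighborFinset x y).1 hy)]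
    simp [hd.degree_eq]
  have := congrFun (aeval_mulVec_of_eigenvector heig (moorePoly d k)) 0
  rw [eval_neg_moorePoly] at this
  have h1 : alternating (1 : ZMod n) = -1 := by simp [alternating, ZMod.not_even_one_of_even hn]
  have h1' : alternating (-1 : ZMod n) = -1 := by simp [alternating, ZMod.not_even_one_of_even hn]
  have h0 : alternating (0 : ZMod n) = 1 := by simp [alternating]
  simp only [Matrix.mulVec, dotProduct, h _ _, mul_add, add_mul, one_mul, mul_one, mul_zero,
    zero_add, zero_sub, zero_mul, mul_ite, ite_mul,
    Finset.sum_add_distrib, Finset.sum_ite_eq', Finset.mem_univ, if_true,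
    sum_alternating hn, h1, h1', h0, Pi.smul_apply, smul_eq_mul] at this
  have hdvd : (1 - (d : ℤ)) ∣ 2 := by
    have : (1 - (d : ℤ)) ∣ σ * -1 + σ * -1 := this ▸ dvd_pow_self _ (by omega)
    rcases hσ with rfl | rfl
    · simpa using this
    · simpa using this
  have hdvd' : ((d : ℤ) - 1) ∣ 2 := by rwa [← neg_sub, neg_dvd] at hdvd
  have := Int.le_of_dvd two_pos hdvd'
  omega

/-- The equation `G_{d,k}(A) = J ± B`, where `B` is the adjacency matrix of an even cycle, has no
solutions among the graphs of degree `d ≥ 5`. -/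
theorem not_satisfiesCycleEquation (hn : Even n) (hd : H.IsRegularOfDegree d)
    (hσ : σ = 1 ∨ σ = -1) (h5 : 5 ≤ d) (hk : 2 ≤ k) : ¬ SatisfiesCycleEquation H d k σ := by
  intro h
  have hone := ZMod.not_even_one_of_even hn
  have hadj : ∀ {x y x' y'}, H.adjMatrix ℤ x y = H.adjMatrix ℤ x' y' →
      (H.Adj x y ↔ H.Adj x' y') := by
    intro x y x' y' e
    simp only [SimpleGraph.adjMatrix_apply] at e
    split_ifs at e <;> simp_all
  have hfew : ∀ p q r s : ZMod n, ∃ b, H.Adj 0 b ∧ b ≠ p ∧ b ≠ q ∧ b ≠ r ∧ b ≠ s := by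
    intro p q r s
    have hcard : Finset.card ({p, q, r, s} : Finset (ZMod n)) < (H.neighborFinset 0).card := by
      rw [SimpleGraph.card_neighborFinset_eq_degree, hd.degree_eq]
      exact (Finset.card_le_four).trans_lt h5
    obtain ⟨b, hb, hb'⟩ := Finset.exists_mem_notMem_of_card_lt_card hcard
    exact ⟨b, by simpa using hb, by simpa using hb'⟩
  obtain ⟨heven, hcirc | hodd⟩ := (h.isWave hd hσ).dichotomy
    (fun i j => by rw [SimpleGraph.adjMatrix_apply]; split_ifs <;> simp) (fun i => by simp)
  · have hshift : ∀ x y z, H.Adj (x + z) (y + z) ↔ H.Adj x y := fun x y z => by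
      refine hadj ((ZMod.eq_add_of_forall_add_one
        (f := fun z => H.adjMatrix ℤ (x + z) (y + z)) (fun t => ?_) z).trans (by simp))
      simpa only [add_assoc] using hcirc (x + t) (y + t)
    obtain ⟨a, ha, -⟩ := hfew 0 0 0 0
    -- The excluded values keep the midpoints distinct and the endpoint `a + b` away from `0`, `1`
    -- and `-1`.
    obtain ⟨b, hb, h₁, h₂, h₃, h₄⟩ := hfew a (-a) (1 - a) (-1 - a)
    have hac : H.Adj a (a + b) := by simpa [add_comm] using (hshift 0 b a).2 hb
    have hbc : H.Adj b (a + b) := by simpa using (hshift 0 a b).2 ha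
    rcases h.eq_of_two_paths hd hk h₁.symm ha hb hac hbc
      (fun e => h₂ (by linear_combination -e)) with e | e
    · exact h₃ (by linear_combination e)
    · exact h₄ (by linear_combination e)
  · have hshift : ∀ x y z, Even (x + y) → (H.Adj (x + z) (y + z) ↔ H.Adj x y) := fun x y z hxy => by
      refine hadj ((ZMod.eq_add_of_forall_add_one
        (f := fun z => H.adjMatrix ℤ (x + z) (y + z)) (fun t => ?_) z).trans (by simp))
      simpa only [add_assoc] using heven (x + t) (y + t) (by
        rw [add_add_add_comm]
        exact hxy.add ⟨t, rfl⟩)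
    have hanti : ∀ x y z, ¬ Even (x + y) →
        (H.Adj (x + z) (y - z) ↔ H.Adj x y) := fun x y z hxy => by
      refine hadj ((ZMod.eq_add_of_forall_add_one
        (f := fun z => H.adjMatrix ℤ (x + z) (y - z)) (fun t => ?_) z).trans (by simp))
      simpa only [add_assoc, sub_sub] using hodd (x + t) (y - t) (by
        convert hxy using 2; ring)
    obtain ⟨x, y, hxy, hadjxy⟩ := h.exists_even_adj hn hd hσ h5 hk
    obtain ⟨a, ha, haeven⟩ : ∃ a, H.Adj 0 a ∧ Even a := by
      refine ⟨y - x, (hshift 0 (y - x) x (by simpa using hxy)).1 (by simpa using hadjxy), hxy⟩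
    -- For even `b` the endpoint `a + b` is even, so only `0` must be avoided there; for odd `b` the
    -- endpoint is `b - a`, and `a ± 1` are excluded to keep it off `±1`.
    obtain ⟨b, hb, h₁, h₂, h₃, h₄⟩ := hfew a (-a) (a + 1) (a - 1)
    by_cases hbeven : Even b
    · have hac : H.Adj a (a + b) := by simpa [add_comm] using (hshift 0 b a (by simpa)).2 hb
      have hbc : H.Adj b (a + b) := by simpa using (hshift 0 a b (by simpa)).2 ha
      rcases h.eq_of_two_paths hd hk h₁.symm ha hb hac hbc
        (fun e => h₂ (by linear_combination -e)) with e | e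
      · exact hone (by simpa [e] using haeven.add hbeven)
      · exact hone (by simpa [e] using haeven.add hbeven)
    · have hac : H.Adj a (b - a) := by simpa using (hanti 0 b a (by simpa)).2 hb
      have hbc : H.Adj b (b - a) := by
        -- Symmetry of adjacency and diagonal invariance make the even neighbours of `0` closed
        -- under negation.
        have h₀ : H.Adj 0 (-a) := by
          simpa using ((hshift 0 a (-a) (by simpa)).2 ha).symm
        simpa [sub_eq_add_neg, add_comm] using (hshift 0 (-a) b (by simpa)).2 h₀
      rcases h.eq_of_two_paths hd hk h₁.symm ha hb hac hbc
        (fun e => h₁ (by linear_combination -e)) with e | e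
      · exact h₃ (by linear_combination e)
      · exact h₄ (by linear_combination e)

end CycleEquation

/-! ### Transfer to arbitrary vertex sets, and the conclusion. -/

theorem IsCycleMatrix.exists_equiv_zmod {V : Type*} [Fintype V] {B : Matrix V V ℤ}
    (hB : IsCycleMatrix B) {n : ℕ}
    (hn : Fintype.card V = n + 3) :
    ∃ p : ZMod (n + 3) ≃ V, ∀ i j, B (p i) (p j) =
      (if j = i + 1 then 1 else 0) + if j = i - 1 then 1 else 0 := by
  unfold IsCycleMatrix at hB
  rw [hn] at hB
  obtain ⟨e, rfl⟩ := hB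
  refine ⟨(show ZMod (n + 3) ≃ V from e.symm), fun i j => ?_⟩
  -- With at least three vertices the two indicators never overlap, so their sum is a 0-1 entry.
  have hne : i + 1 ≠ i - 1 := fun h => by
    have h2 : ((2 : ℕ) : ZMod (n + 3)) = 0 := by push_cast; linear_combination h
    rw [ZMod.natCast_eq_zero_iff] at h2
    exact absurd (Nat.le_of_dvd two_pos h2) (by omega)
  have hadj : (SimpleGraph.cycleGraph (n + 3)).Adj i j ↔ j = i + 1 ∨ j = i - 1 := by
    refine (SimpleGraph.cycleGraph_adj (n := n + 1)).trans ?_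
    change i - j = (1 : ZMod (n + 3)) ∨ j - i = (1 : ZMod (n + 3)) ↔ _
    rw [or_comm, sub_eq_iff_eq_add', sub_eq_iff_eq_add', eq_sub_iff_add_eq, eq_comm (a := i)]
  refine (congrArg₂ ((SimpleGraph.cycleGraph (n + 3)).adjMatrix ℤ) (e.apply_symm_apply i)
    (e.apply_symm_apply j)).trans ((SimpleGraph.adjMatrix_apply ..).trans ?_)
  simp only [hadj]
  by_cases h₁ : j = i + 1
  · simp [h₁, hne]
  · simp [h₁]

/-- No graph of degree `d ≥ 5` and even order satisfies `G_{d,k}(A) = J ± B` for `k ≥ 2` and a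
cycle matrix `B`. -/
theorem aeval_moorePoly_ne_add_cycle {V : Type*} [Fintype V] [DecidableEq V] [Nonempty V]
    {G : SimpleGraph V} [DecidableRel G.Adj] {d k : ℕ} (hd : G.IsRegularOfDegree d)
    (h5 : 5 ≤ d) (hk : 2 ≤ k) (hn : Even (Fintype.card V))
    {σ : ℤ} (hσ : σ = 1 ∨ σ = -1) {B : Matrix V V ℤ} (hB : IsCycleMatrix B) :
    Polynomial.aeval (G.adjMatrix ℤ) (moorePoly d k) ≠ Matrix.of (fun _ _ => 1) + σ • B := by
  intro h
  have hcard : d < Fintype.card V := hd.degree_eq (Classical.arbitrary V) ▸ G.degree_lt_card_verts _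
  obtain ⟨n, hn'⟩ := Nat.exists_eq_add_of_le' (show 3 ≤ Fintype.card V by omega)
  obtain ⟨p, hp⟩ := hB.exists_equiv_zmod hn'
  classical
  have hA : (G.comap p).adjMatrix ℤ = Matrix.reindexAlgEquiv ℤ ℤ p.symm (G.adjMatrix ℤ) := by
    ext i j
    simp [SimpleGraph.adjMatrix_apply]
  refine not_satisfiesCycleEquation (n := n + 3) (H := G.comap p) (hn' ▸ hn) (d := d) (k := k)
    (fun v => ?_) hσ h5 hk fun i j => ?_
  · rw [← hd.degree_eq (p v)]
    exact ((SimpleGraph.Iso.comap p G).degree_eq v).symm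
  · rw [hA, Polynomial.aeval_algHom_apply, h]
    rw [Matrix.coe_reindexAlgEquiv, Matrix.reindex_apply, Matrix.submatrix_apply,
      Matrix.add_apply, Matrix.smul_apply, Matrix.of_apply, Equiv.symm_symm, hp, smul_eq_mul]

/-- As `d - 1` is even, the geometric sum is odd through its term `1`; times `d`, plus one, it is
even. -/
theorem even_mooreBound {d k : ℕ} (hd : Odd d) (hk : k ≠ 0) : Even (mooreBound d k) := by
  obtain ⟨k, rfl⟩ := Nat.exists_eq_succ_of_ne_zero hk
  obtain ⟨c, rfl⟩ := hd
  have : Even (∑ i ∈ Finset.range k, (2 * c + 1 - 1) ^ (i + 1)) :=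
    Finset.even_sum _ fun i _ => (by simp : Even (2 * c + 1 - 1)).pow_of_ne_zero (by omega)
  unfold mooreBound
  rw [Finset.sum_range_succ', pow_zero]
  exact odd_one.add_odd ((odd_two_mul_add_one c).mul (this.add_odd odd_one))

theorem not_hasCyclicDefect {V : Type*} [Fintype V] [DecidableEq V]
    {G : SimpleGraph V} [DecidableRel G.Adj] {d : ℕ} (h5 : 5 ≤ d)
    (hd : Odd d) (D : ℕ) : ¬ HasCyclicDefect G d D := by
  intro h
  have hD := h.two_le
  obtain ⟨B, hB, hG⟩ := h.cyclic
  have heven := even_mooreBound hd (show D ≠ 0 by omega)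
  have hbig : 6 ≤ mooreBound d D := by
    unfold mooreBound
    have : 1 ≤ ∑ i ∈ Finset.range D, (d - 1) ^ i :=
      Finset.single_le_sum (f := fun i => (d - 1) ^ i) (fun _ _ => Nat.zero_le _)
        (Finset.mem_range.2 (show 0 < D by omega))
    nlinarith
  rw [← h.order] at heven hbig
  have : Nonempty V := Fintype.card_pos_iff.1 (by omega)
  exact aeval_moorePoly_ne_add_cycle h.regular h5 hD (by simpa [Nat.even_add] using heven)
    (Or.inl rfl) hB (by rw [hG, one_smul])

theorem not_hasCyclicExcess {V : Type*} [Fintype V] [DecidableEq V]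
    {G : SimpleGraph V} [DecidableRel G.Adj] {d : ℕ} (h5 : 5 ≤ d)
    (hd : Odd d) (g : ℕ) : ¬ HasCyclicExcess G d g := by
  intro h
  have hg := h.five_le
  obtain ⟨B, hB, hG⟩ := h.cyclic
  have heven := even_mooreBound hd (show g / 2 ≠ 0 by omega)
  have : Nonempty V := Fintype.card_pos_iff.1 (by rw [h.order]; omega)
  exact aeval_moorePoly_ne_add_cycle h.regular h5 (show 2 ≤ g / 2 by omega)
    (by rw [h.order]; exact heven.add even_two) (Or.inr rfl) hB
    (by rw [hG, neg_one_smul, sub_eq_add_neg])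

/-- There are no graphs of odd degree `d ≥ 5` with cyclic defect or cyclic excess. -/
theorem cyclicGraphClasses_eq_empty {d : ℕ} (h5 : 5 ≤ d) (hd : Odd d) :
    cyclicGraphClasses d = ∅ := by
  rw [Set.eq_empty_iff_forall_notMem]
  rintro c ⟨n, G, -, ⟨D, h⟩ | ⟨g, h⟩⟩ <;>
  let : DecidableRel G.Adj := Classical.decRel _
  · exact not_hasCyclicDefect h5 hd D h
  · exact not_hasCyclicExcess h5 hd g h

theorem mainTheorem1 :
    (∀ d : ℕ, 5 ≤ d → Odd d → (cyclicGraphClasses d).Finite) ∧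
    (fun d : ℕ => ((cyclicGraphClasses d).ncard : ℝ))
      =O[atTop ⊓ 𝓟 {d : ℕ | Odd d}] (fun d : ℕ => (64 / 3 : ℝ) * (d : ℝ) ^ (3 / 2 : ℝ)) ∧
    (∀ ε : ℝ, 0 < ε → ∃ d₀ : ℕ, ∀ d : ℕ, d₀ ≤ d → Odd d →
      ((cyclicGraphClasses d).ncard : ℝ) ≤ (64 / 3 + ε) * (d : ℝ) ^ (3 / 2 : ℝ)) := by
  refine ⟨fun d h5 hd => ?_, ?_, fun ε hε => ⟨5, fun d h5 hd => ?_⟩⟩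
  · rw [cyclicGraphClasses_eq_empty h5 hd]
    exact Set.finite_empty
  · refine IsBigO.of_bound 1 (eventually_inf_principal.2 ?_)
    filter_upwards [eventually_ge_atTop 5] with d h5 hd
    rw [cyclicGraphClasses_eq_empty h5 hd]
    simp only [Set.ncard_empty, Nat.cast_zero, norm_zero, one_mul]
    positivity
  · rw [cyclicGraphClasses_eq_empty h5 hd]
    simp only [Set.ncard_empty, Nat.cast_zero]
    positivity
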